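/- Conventions. A linear code $\mathcal{C}\subseteq\mathbb{F}^n$ is an $[n,k,d]$ code if it has dimension $k$ and minimum Hamming distance $d$. For $1\le r\le k$ and $\delta\ge 2$, an $(r,\delta)$-repair set of $\mathcal{C}$ is a set $A$ of coordinates with $|A|\le r+\delta-1$ such that for every $l\in A$ and every $L\subseteq A\setminus\{l\}$ with $|L|=\max\{|A|-(\delta-1),0\}$, the symbol $c_l$ is a linear function of the symbols $c_i$, $i\in L$, for $c\in\mathcal{C}$. The code has $(r,\delta)_a$-locality if every coordinate lies in an $(r,\delta)$-repair set. A set $S$ in an extension field of $\mathbb{F}_q$ is $t$-wise independent over $\mathbb{F}_q$ if every $T\subseteq S$ with $|T|\le t$ is linearly independent over $\mathbb{F}_q$. Theorem. Let $n=w(r+\delta-1)+m$ and $k=ur+v$, where $w,u,r,v,\delta,m$ are nonnegative integers with $0<m\le\delta-1$, $r>v>\lfloor r/2\rfloor$ and $u\ge 2r+\delta-1$, and assume that $h=n-k-m-w(\delta-1)\ge 0$. Let $\mathbb{F}_q\subseteq\mathbb{F}_{q_1}$ be finite fields, let $P_1$ be an $(m+\delta-1)\times(m+r+\delta-1)$ parity-check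 matrix of an $[m+r+\delta-1,r,m+\delta]$ MDS code over $\mathbb{F}_q$, and let $P_2$ be a $(\delta-1)\times(r+\delta-1)$ parity-check matrix of an $[r+\delta-1,r,\delta]$ MDS code over $\mathbb{F}_q$. Let $S=\{\alpha_1,\dots,\alpha_n\}\subseteq\mathbb{F}_{q_1}$ be a set of $n$ elements, enumerated in any order, that is $(h+(w+1-u)(\delta-1))$-wise independent over $\mathbb{F}_q$. Let $\mathcal{C}(S,h)\subseteq\mathbb{F}_{q_1}^n$ be the code with parity-check matrix $$\begin{pmatrix}P_1&0&\cdots&0\\0&P_2&\cdots&0\\\vdots&\vdots&\ddots&\vdots\\0&0&\cdots&P_2\\H_1&H_2&\cdots&H_w\end{pmatrix},\qquad (H_1,\dots,H_w)=\bigl(\alpha_j^{q^{i}}\bigr)_{0\le i\le h-1,\ 1\le j\le n},$$ with one block $P_1$ and $w-1$ blocks $P_2$. Then $\mathcal{C}(S,h)$ is an $[n,k,d]$ code over $\mathbb{F}_{q_1}$ with $(r,\delta)_a$-locality and $d=h+(w-u)(\delta-1)+1$, and it is optimal: $$d=n-k+1-\left\lceil\frac{k}{r}\right\rceil(\delta-1)+(\delta-1-m),$$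 and the right-hand side is an upper bound on the minimum distance of every linear code of length $n$ and dimension $k$ with $(r,\delta)_a$-locality over any finite field. -/

import Mathlib

/-- The linear code with parity-check matrix `H`: all vectors `c` with `H c = 0`. -/
def parityCheckCode {ρ ι K : Type*} [Fintype ι] [Field K] (H : Matrix ρ ι K) :
    Submodule K (ι → K) :=
  LinearMap.ker H.mulVecLin

open Classical in
/-- `C` is a linear `[n, k, d]` code: its length is `n`, its dimension is `k`, and its minimum
Hamming distance (the least distance between two distinct codewords) is `d`. -/
def IsLinearCodeWithParams {ι K : Type*} [Fintype ι] [Field K] (C : Submodule K (ι → K))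
    (n k d : ℕ) : Prop :=
  Fintype.card ι = n ∧ Module.finrank K C = k ∧
    IsLeast {e : ℕ | ∃ x ∈ C, ∃ y ∈ C, x ≠ y ∧ hammingDist x y = e} d

/-- `A` is an `(r, δ)`-repair set of `C`: it has at most `r + δ - 1` elements, and for every `l ∈ A`
and every `L ⊆ A \ {l}` with `|L| = |A| - (δ - 1)` the symbol `c_l` is a linear function of the
symbols `c_i`, `i ∈ L`, for `c ∈ C`.

If `|A| < δ - 1` the truncated difference makes `L` empty, so that all symbols in `A` vanish. This
is what the equivalent condition `d(C_A) ≥ δ` on the punctured code says for such a set. -/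
def IsRepairSet {ι K : Type*} [Field K] (C : Submodule K (ι → K)) (r δ : ℕ)
    (A : Finset ι) : Prop :=
  A.card ≤ r + δ - 1 ∧
    ∀ l ∈ A, ∀ L : Finset ι, L ⊆ A → l ∉ L → L.card = A.card - (δ - 1) →
      ∃ a : ι → K, ∀ c ∈ C, c l = ∑ i ∈ L, a i * c i

/-- `C` has `(r, δ)_a`-locality (all-symbol locality), where `1 ≤ r ≤ dim C` and `δ ≥ 2`: every
coordinate lies in an `(r, δ)`-repair set. -/
def HasAllSymbolLocality {ι K : Type*} [Field K] (C : Submodule K (ι → K)) (r δ : ℕ) : Prop :=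
  1 ≤ r ∧ r ≤ Module.finrank K C ∧ 2 ≤ δ ∧
    ∀ i : ι, ∃ A : Finset ι, IsRepairSet C r δ A ∧ i ∈ A

/-- `S ⊆ L` is `t`-wise independent over `F`: every `T ⊆ S` with `|T| ≤ t` is linearly independent
over `F`. -/
def IsWiseIndependent (F : Type*) {L : Type*} [Field F] [Field L] [Algebra F L]
    (S : Set L) (t : ℕ) : Prop :=
  ∀ T : Finset L, (T : Set L) ⊆ S → T.card ≤ t → LinearIndependent F (fun x : T => (x : L))

/-- The Moore matrix with rows `α, α^q, …, α^(q^(h-1))`. -/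
def mooreMatrix {ι L : Type*} [Field L] (q h : ℕ) (α : ι → L) : Matrix (Fin h) ι L :=
  Matrix.of fun i j => α j ^ q ^ (i : ℕ)

/-- The coordinates of the code: one block of size `m + r + δ - 1`, followed by `w - 1` blocks of
size `r + δ - 1` (the pair `(x, j)` is position `x` of the `j`-th of these blocks). -/
abbrev BlockCoord (w r δ m : ℕ) : Type :=
  Fin (m + r + δ - 1) ⊕ (Fin (r + δ - 1) × Fin (w - 1))

/-- The parity-check matrix
```
  P₁  0   …  0
  0   P₂  …  0
  ⋮       ⋱
  0   0   …  P₂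
  H₁  H₂  …  H_w
```
with one block `P₁`, with `w - 1` blocks `P₂`, and with `(H₁, …, H_w)` the `h`-row Moore matrix
of `α`, where `q = |F|`. -/
def blockParityCheck {F L : Type*} [Field F] [Fintype F] [Field L] [Algebra F L]
    {w r δ m : ℕ} (h : ℕ)
    (P₁ : Matrix (Fin (m + δ - 1)) (Fin (m + r + δ - 1)) F)
    (P₂ : Matrix (Fin (δ - 1)) (Fin (r + δ - 1)) F)
    (α : BlockCoord w r δ m → L) :
    Matrix ((Fin (m + δ - 1) ⊕ (Fin (δ - 1) × Fin (w - 1))) ⊕ Fin h) (BlockCoord w r δ m) L :=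
  Matrix.fromRows
    (Matrix.fromBlocks (P₁.map (algebraMap F L)) 0 0
      (Matrix.blockDiagonal fun _ : Fin (w - 1) => P₂.map (algebraMap F L)))
    (mooreMatrix (Fintype.card F) h α)

/-- The value `n - k + 1 - ⌈k / r⌉ (δ - 1) + (δ - 1 - m)` of the upper bound on the minimum
distance. -/
def distanceBound (n k r δ m : ℕ) : ℤ :=
  (n : ℤ) - k + 1 - ⌈(k : ℚ) / r⌉ * ((δ : ℤ) - 1) + ((δ : ℤ) - 1 - m)

/-!
Write `s = δ - 1`.

*Upper bound.* The symbols are functionals spanning the dual of the code, and `d + k + e ≤ n + 1` as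
soon as some nonspanning set of symbols has nullity (cardinality minus rank) at least `e`; we need
`e = us + m`. Adding to a set a repair set outside its closure raises the rank by at most `r` and
the nullity by at least `s`. Start from a chain `T` of `j` such steps maximizing the defect
`j(r + s) - |T|`, among the chains of defect at least `j / 2`. By maximality, the repair sets
outside the closure of `T` have `r + s` elements and are disjoint from `T`, and two of them that
intersect have the same closure modulo `T`. A maximal family of disjoint ones cannot cover the
`n = w(r + s) + m` symbols: at least `m` of them are left over. Each of these depends on `T` and at
most one member of the family, so a chain of length at most `j + m ≤ u` has `m` further symbols in
its closure; these give the additional nullity `m`, and the chain is prolonged to length `u`.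

*Construction.* The block rows define the extension of scalars of a code `W` over the small field.
The words of `W` supported on a set `T` with `|T| ≤ h + (w - u)s` form a space of dimension at
most `h`, and the `h` Moore rows kill no nonzero word of its extension, since the `αᵢ` with `i ∈ T`
are independent. Hence `d ≥ h + (w - u)s + 1`. Counting rows bounds the dimension below by `k`, and
the upper bound forces both inequalities to be equalities.
-/

section VectorFamily

open Finset

variable {ι K V : Type*} [DivisionRing K] [AddCommGroup V] [Module K V]

/-- The closure, as a subspace, of the index set `T` in the matroid of the family `φ`. -/
def spanOn (K : Type*) {ι V : Type*} [DivisionRing K] [AddCommGroup V] [Module K V]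
    (φ : ι → V) (T : Finset ι) : Submodule K V :=
  Submodule.span K (φ '' T)

/-- The rank of the index set `T` in the matroid of the family `φ`. -/
noncomputable def rankOn (K : Type*) {ι V : Type*} [DivisionRing K] [AddCommGroup V] [Module K V]
    (φ : ι → V) (T : Finset ι) : ℕ :=
  Module.finrank K (spanOn K φ T)

variable {φ : ι → V}

theorem spanOn_le_iff {T : Finset ι} {W : Submodule K V} :
    spanOn K φ T ≤ W ↔ ∀ i ∈ T, φ i ∈ W := by
  simp [spanOn, Submodule.span_le, Set.subset_def]

theorem mem_spanOn {T : Finset ι} {i : ι} (hi : i ∈ T) : φ i ∈ spanOn K φ T :=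
  spanOn_le_iff.1 le_rfl i hi

theorem spanOn_mono {S T : Finset ι} (h : S ⊆ T) : spanOn K φ S ≤ spanOn K φ T :=
  Submodule.span_mono (Set.image_mono (coe_subset.2 h))

instance finiteDimensional_spanOn (T : Finset ι) : FiniteDimensional K (spanOn K φ T) :=
  FiniteDimensional.span_of_finite K (T.finite_toSet.image φ)

theorem rankOn_le_card (T : Finset ι) : rankOn K φ T ≤ #T := by
  classical
  rw [rankOn, spanOn, ← coe_image]
  exact (finrank_span_finset_le_card _).trans card_image_le

theorem spanOn_ne_top_of_rankOn_lt {T : Finset ι} (h : rankOn K φ T < Module.finrank K V) :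
    spanOn K φ T ≠ ⊤ := by
  intro htop
  rw [rankOn, htop, finrank_top] at h
  exact h.false

/-- An `(r, s + 1)`-repair set, seen in the family of coordinate functionals: any `#A - s` members
of `A` already span all of `A`. -/
structure IsRepairGroup (K : Type*) {ι V : Type*} [DivisionRing K] [AddCommGroup V] [Module K V]
    (φ : ι → V) (r s : ℕ) (A : Finset ι) : Prop where
  card_le : #A ≤ r + s
  spanOn_le : ∀ L ⊆ A, #L = #A - s → spanOn K φ A ≤ spanOn K φ L

/-- `φ` spans `V` and every index lies in a repair group. -/
structure HasLocality (K : Type*) {ι V : Type*} [DivisionRing K] [AddCommGroup V] [Module K V]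
    (φ : ι → V) (r s : ℕ) : Prop where
  span_eq_top : Submodule.span K (Set.range φ) = ⊤
  exists_mem : ∀ i, ∃ A, IsRepairGroup K φ r s A ∧ i ∈ A

/-- Every nonspanning index set has nullity `#T - rankOn K φ T` less than `e`. For the coordinate
functionals of a linear code this is a lower bound on the minimum distance. -/
def NullityLT (K : Type*) {ι V : Type*} [DivisionRing K] [AddCommGroup V] [Module K V]
    (φ : ι → V) (e : ℕ) : Prop :=
  ∀ T : Finset ι, spanOn K φ T ≠ ⊤ → #T < rankOn K φ T + e

variable {r s : ℕ} {A T : Finset ι} {𝓑 I : Finset (Finset ι)}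

theorem HasLocality.exists_isRepairGroup_not_le (hφ : HasLocality K φ r s)
    (hT : spanOn K φ T ≠ ⊤) :
    ∃ A, IsRepairGroup K φ r s A ∧ ¬ spanOn K φ A ≤ spanOn K φ T := by
  by_contra! hall
  refine hT (top_le_iff.1 ?_)
  rw [← hφ.span_eq_top, Submodule.span_le, Set.range_subset_iff]
  intro i
  obtain ⟨A, hA, hi⟩ := hφ.exists_mem i
  exact hall A hA (mem_spanOn hi)

/-- Pairwise disjoint repair groups, none of them contained in the closure of `T`. -/
structure IsRepairPacking (K : Type*) {ι V : Type*} [DivisionRing K] [AddCommGroup V] [Module K V]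
    (φ : ι → V) (r s : ℕ) (T : Finset ι) (𝓑 : Finset (Finset ι)) : Prop where
  isRepairGroup : ∀ B ∈ 𝓑, IsRepairGroup K φ r s B
  not_le : ∀ B ∈ 𝓑, ¬ spanOn K φ B ≤ spanOn K φ T
  pairwiseDisjoint : (𝓑 : Set (Finset ι)).PairwiseDisjoint id

variable (K φ r s T) in
theorem exists_maximal_isRepairPacking [Finite ι] :
    ∃ 𝓑, Maximal (IsRepairPacking K φ r s T) 𝓑 :=
  (Set.toFinite {𝓑 | IsRepairPacking K φ r s T 𝓑}).exists_maximal
    ⟨∅, by simp, by simp, by simp⟩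

theorem IsRepairPacking.subset (h𝓑 : IsRepairPacking K φ r s T 𝓑) (hI : I ⊆ 𝓑) :
    IsRepairPacking K φ r s T I :=
  ⟨fun B hB ↦ h𝓑.isRepairGroup B (hI hB), fun B hB ↦ h𝓑.not_le B (hI hB),
    h𝓑.pairwiseDisjoint.subset (coe_subset.2 hI)⟩

theorem IsRepairPacking.exists_not_disjoint_of_maximal (h𝓑 : Maximal (IsRepairPacking K φ r s T) 𝓑)
    (hA : IsRepairGroup K φ r s A) (hAT : ¬ spanOn K φ A ≤ spanOn K φ T) :
    ∃ B ∈ 𝓑, A = B ∨ ¬ Disjoint A B := by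
  classical
  by_contra! hall
  have hins : IsRepairPacking K φ r s T (insert A 𝓑) := by
    refine ⟨?_, ?_, ?_⟩
    · simpa [hA] using h𝓑.prop.isRepairGroup
    · simpa [hAT] using h𝓑.prop.not_le
    · rw [coe_insert, Set.pairwiseDisjoint_insert]
      exact ⟨h𝓑.prop.pairwiseDisjoint, fun B hB _ ↦ (hall B hB).2⟩
  exact (hall A (h𝓑.le_of_ge hins (subset_insert A 𝓑) (mem_insert_self A 𝓑))).1 rfl

variable [DecidableEq ι]

theorem spanOn_union (S T : Finset ι) :
    spanOn K φ (S ∪ T) = spanOn K φ S ⊔ spanOn K φ T := by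
  simp [spanOn, Set.image_union, Submodule.span_union]

theorem rankOn_union_le (S T : Finset ι) : rankOn K φ (S ∪ T) ≤ rankOn K φ S + #(T \ S) := by
  rw [← union_sdiff_self_eq_union, rankOn, spanOn_union]
  exact (Submodule.finrank_add_le_finrank_add_finrank _ _).trans
    (Nat.add_le_add_left (rankOn_le_card _) _)

theorem rankOn_union_eq_of_spanOn_le {S T : Finset ι} (h : spanOn K φ T ≤ spanOn K φ S) :
    rankOn K φ (S ∪ T) = rankOn K φ S := by
  rw [rankOn, spanOn_union, sup_eq_left.2 h, rankOn]

namespace IsRepairGroup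

theorem rankOn_union_le_add_card_sdiff (hA : IsRepairGroup K φ r s A) {L : Finset ι} (hLA : L ⊆ A)
    (hL : #L = #A - s) (T : Finset ι) : rankOn K φ (T ∪ A) ≤ rankOn K φ T + #(L \ T) := by
  rw [rankOn, spanOn_union, (hA.spanOn_le L hLA hL).antisymm (spanOn_mono hLA), ← spanOn_union]
  exact _root_.rankOn_union_le T L

theorem rankOn_union_le (hA : IsRepairGroup K φ r s A) (T : Finset ι) :
    rankOn K φ (T ∪ A) ≤ rankOn K φ T + r := by
  obtain ⟨L, hLA, hL⟩ := exists_subset_card_eq (Nat.sub_le #A s)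
  have hLT : #(L \ T) ≤ #L := card_le_card sdiff_subset
  have hrank := hA.rankOn_union_le_add_card_sdiff hLA hL T
  have hcard := hA.card_le
  omega

theorem rankOn_union_add_le (hA : IsRepairGroup K φ r s A)
    (hAT : ¬ spanOn K φ A ≤ spanOn K φ T) :
    rankOn K φ (T ∪ A) + s ≤ rankOn K φ T + #(A \ T) := by
  have hlt : #(A ∩ T) < #A - s := by
    by_contra! hle
    obtain ⟨L, hL, hcard⟩ := exists_subset_card_eq hle
    exact hAT ((hA.spanOn_le L (hL.trans inter_subset_left) hcard).trans
      (spanOn_mono (hL.trans inter_subset_right)))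
  obtain ⟨L, hTL, hLA, hL⟩ := exists_subsuperset_card_eq inter_subset_left hlt.le (Nat.sub_le #A s)
  have hrank := hA.rankOn_union_le_add_card_sdiff hLA hL T
  have hLT : L ∩ T = A ∩ T :=
    (inter_subset_inter_right hLA).antisymm (subset_inter hTL inter_subset_right)
  have hcardL := card_sdiff_add_card_inter L T
  have hcardA := card_sdiff_add_card_inter A T
  rw [hLT] at hcardL
  omega

end IsRepairGroup

/-- `T` is obtained from `∅` by adding `j` repair groups in succession, none of them contained in
the closure of what was there before. -/
inductive IsRepairChain (K : Type*) {ι V : Type*} [DivisionRing K] [AddCommGroup V] [Module K V]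
    [DecidableEq ι] (φ : ι → V) (r s : ℕ) : ℕ → Finset ι → Prop
  | empty : IsRepairChain K φ r s 0 ∅
  | union {j : ℕ} {T A : Finset ι} : IsRepairChain K φ r s j T → IsRepairGroup K φ r s A →
      ¬ spanOn K φ A ≤ spanOn K φ T → IsRepairChain K φ r s (j + 1) (T ∪ A)

namespace IsRepairChain

variable {j : ℕ}

theorem rankOn_le (hT : IsRepairChain K φ r s j T) : rankOn K φ T ≤ j * r := by
  induction hT with
  | empty => simpa using rankOn_le_card (K := K) (φ := φ) ∅
  | union _ hA _ ih =>
    rw [Nat.add_one_mul]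
    exact (hA.rankOn_union_le _).trans (Nat.add_le_add_right ih r)

theorem rankOn_add_le_card (hT : IsRepairChain K φ r s j T) : rankOn K φ T + j * s ≤ #T := by
  induction hT with
  | empty => simpa using rankOn_le_card (K := K) (φ := φ) ∅
  | @union j T A _ hA hAT ih =>
    have hstep := hA.rankOn_union_add_le hAT
    have hcard := card_sdiff_add_card A T
    rw [union_comm] at hcard
    rw [Nat.add_one_mul]
    omega

end IsRepairChain

variable {u m j : ℕ}

omit [DecidableEq ι] in
theorem NullityLT.card_lt (hnull : NullityLT K φ (u * s + m)) (hφ : HasLocality K φ r s)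
    (hu : u * r < Module.finrank K V) (hj : j ≤ u) (hT : rankOn K φ T ≤ j * r) :
    #T < rankOn K φ T + j * s + m := by
  classical
  induction hj using Nat.decreasingInduction generalizing T with
  | self =>
    rw [add_assoc]
    exact hnull T (spanOn_ne_top_of_rankOn_lt (hT.trans_lt hu))
  | of_succ j hj ih =>
    have hlt := (hT.trans (Nat.mul_le_mul_right r (Nat.le_of_lt hj))).trans_lt hu
    obtain ⟨A, hA, hAT⟩ := hφ.exists_isRepairGroup_not_le (spanOn_ne_top_of_rankOn_lt hlt)
    have hnext := ih (T := T ∪ A) (by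
      rw [Nat.add_one_mul]
      exact (hA.rankOn_union_le T).trans (Nat.add_le_add_right hT r))
    have hstep := hA.rankOn_union_add_le hAT
    have hcard := card_sdiff_add_card A T
    rw [union_comm] at hcard
    rw [Nat.add_one_mul] at hnext
    omega

namespace IsRepairChain

theorem card_lt_of_spanOn_le (hT : IsRepairChain K φ r s j T)
    (hnull : NullityLT K φ (u * s + m)) (hφ : HasLocality K φ r s)
    (hu : u * r < Module.finrank K V) (hj : j ≤ u) {X : Finset ι} (hdisj : Disjoint T X)
    (hX : spanOn K φ X ≤ spanOn K φ T) : #X < m := by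
  have hrank := rankOn_union_eq_of_spanOn_le hX
  have hlt := hnull.card_lt hφ hu hj (T := T ∪ X) (hrank.trans_le hT.rankOn_le)
  have hle := hT.rankOn_add_le_card
  rw [card_union_of_disjoint hdisj, hrank] at hlt
  omega

theorem mul_add_le_card_add {v : ℕ} (hT : IsRepairChain K φ r s j T)
    (hnull : NullityLT K φ (u * s + m)) (hφ : HasLocality K φ r s) (hv : 0 < v) (hms : m ≤ s)
    (hk : u * r + v ≤ Module.finrank K V) (hj : j ≤ u + 1) :
    j * (r + s) + v ≤ #T + r := by
  induction hj using Nat.decreasingInduction generalizing T with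
  | self =>
    have hle := hT.rankOn_add_le_card
    by_cases htop : spanOn K φ T = ⊤
    · rw [rankOn, htop, finrank_top] at hle
      grind
    · have hlt := hnull T htop
      grind
  | of_succ j hj ih =>
    have hlt : rankOn K φ T < Module.finrank K V := by
      have := Nat.mul_le_mul_right r (Nat.le_of_lt_succ hj)
      have := hT.rankOn_le
      omega
    obtain ⟨A, hA, hAT⟩ := hφ.exists_isRepairGroup_not_le (spanOn_ne_top_of_rankOn_lt hlt)
    have hnext := ih (hT.union hA hAT)
    have hcard := card_union_le T A
    have hAcard := hA.card_le
    rw [Nat.add_one_mul] at hnext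
    omega

end IsRepairChain

/-- A repair chain of length `j ≤ u` and defect `j * (r + s) - #T ≥ j / 2` whose defect is maximal
among all such chains. -/
structure IsSaturatedChain (K : Type*) {ι V : Type*} [DivisionRing K] [AddCommGroup V] [Module K V]
    [DecidableEq ι] (φ : ι → V) (r s u j : ℕ) (T : Finset ι) : Prop where
  isRepairChain : IsRepairChain K φ r s j T
  le : j ≤ u
  add_two_mul_card_le : j + 2 * #T ≤ 2 * (j * (r + s))
  defect_le : ∀ j' T', IsRepairChain K φ r s j' T' → j' ≤ u →
    j' + 2 * #T' ≤ 2 * (j' * (r + s)) → j' * (r + s) + #T ≤ j * (r + s) + #T'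

variable (K φ r s u) in
theorem exists_isSaturatedChain [Finite ι] : ∃ j T, IsSaturatedChain K φ r s u j T := by
  let chains : Set (ℕ × Finset ι) :=
    {p | IsRepairChain K φ r s p.1 p.2 ∧ p.1 ≤ u ∧ p.1 + 2 * #p.2 ≤ 2 * (p.1 * (r + s))}
  have hfin : chains.Finite :=
    ((Set.finite_Iic u).prod Set.finite_univ).subset fun p hp ↦ ⟨hp.2.1, trivial⟩
  obtain ⟨⟨j, T⟩, ⟨hT, hj, hdef⟩, hmax⟩ := Set.exists_max_image chains
    (fun p ↦ (p.1 * (r + s) : ℤ) - #p.2) hfin ⟨(0, ∅), .empty, u.zero_le, by simp⟩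
  refine ⟨j, T, hT, hj, hdef, fun j' T' hT' hj' hdef' ↦ ?_⟩
  have hle := hmax (j', T') ⟨hT', hj', hdef'⟩
  dsimp only at hle
  zify
  linarith

namespace IsSaturatedChain

variable {B B' : Finset ι}

theorem card_eq_and_disjoint (hT : IsSaturatedChain K φ r s u j T) (hj : j + 1 ≤ u)
    (hB : IsRepairGroup K φ r s B) (hBT : ¬ spanOn K φ B ≤ spanOn K φ T) :
    #B = r + s ∧ Disjoint T B := by
  have hmax := hT.defect_le _ _ (hT.isRepairChain.union hB hBT) hj
  have hdef := hT.add_two_mul_card_le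
  have hcard := card_union_add_card_inter T B
  have hBcard := hB.card_le
  rw [Nat.add_one_mul j] at hmax
  rw [disjoint_iff_inter_eq_empty, ← card_eq_zero]
  omega

theorem disjoint_of_not_le (hT : IsSaturatedChain K φ r s u j T) (hj : j + 2 ≤ u)
    (hB : IsRepairGroup K φ r s B) (hBT : ¬ spanOn K φ B ≤ spanOn K φ T)
    (hB' : IsRepairGroup K φ r s B') (hB'T : ¬ spanOn K φ B' ≤ spanOn K φ (T ∪ B)) :
    Disjoint B B' := by
  have hmax := hT.defect_le _ _ ((hT.isRepairChain.union hB hBT).union hB' hB'T) hj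
  have hdef := hT.add_two_mul_card_le
  have hcard := card_union_le T B
  have hcard' := card_union_add_card_inter (T ∪ B) B'
  have hinter : #(B ∩ B') ≤ #((T ∪ B) ∩ B') :=
    card_le_card (inter_subset_inter_right subset_union_right)
  have hBcard := hB.card_le
  have hBcard' := hB'.card_le
  rw [Nat.add_one_mul (j + 1), Nat.add_one_mul j] at hmax
  rw [disjoint_iff_inter_eq_empty, ← card_eq_zero]
  omega

theorem le_two_mul {v : ℕ} (hT : IsSaturatedChain K φ r s u j T)
    (hnull : NullityLT K φ (u * s + m)) (hφ : HasLocality K φ r s) (hv : 0 < v) (hms : m ≤ s)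
    (hk : u * r + v ≤ Module.finrank K V) : j ≤ 2 * (r - v) := by
  have hdef := hT.isRepairChain.mul_add_le_card_add hnull hφ hv hms hk (hT.le.trans u.le_succ)
  have := hT.add_two_mul_card_le
  omega

theorem exists_mem_spanOn_union_biUnion (hT : IsSaturatedChain K φ r s u j T) (hj : j + 2 ≤ u)
    (hφ : HasLocality K φ r s) (h𝓑 : Maximal (IsRepairPacking K φ r s T) 𝓑) (i : ι) :
    ∃ I ⊆ 𝓑, #I ≤ 1 ∧ φ i ∈ spanOn K φ (T ∪ I.biUnion id) := by
  obtain ⟨A, hA, hi⟩ := hφ.exists_mem i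
  by_cases hAT : spanOn K φ A ≤ spanOn K φ T
  · exact ⟨∅, empty_subset _, by simp, by simpa using hAT (mem_spanOn hi)⟩
  obtain ⟨B, hB, hAB⟩ := IsRepairPacking.exists_not_disjoint_of_maximal h𝓑 hA hAT
  refine ⟨{B}, singleton_subset_iff.2 hB, by simp, ?_⟩
  rw [singleton_biUnion, id]
  obtain rfl | hAB := hAB
  · exact mem_spanOn (mem_union_right T hi)
  · by_contra hmem
    exact hAB (hT.disjoint_of_not_le hj (h𝓑.prop.isRepairGroup B hB) (h𝓑.prop.not_le B hB) hA
      fun hle ↦ hmem (hle (mem_spanOn hi))).symm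

theorem isRepairChain_union_biUnion (hT : IsSaturatedChain K φ r s u j T) (hj : j + 1 ≤ u)
    (hnull : NullityLT K φ (u * s + m)) (hφ : HasLocality K φ r s)
    (hu : u * r < Module.finrank K V) (hms : m ≤ s) (hI : IsRepairPacking K φ r s T I)
    (hjI : j + #I ≤ u) : IsRepairChain K φ r s (j + #I) (T ∪ I.biUnion id) := by
  induction I using Finset.induction with
  | empty => simpa using hT.isRepairChain
  | insert B I hBI ih =>
    rw [card_insert_of_notMem hBI] at hjI ⊢
    rw [biUnion_insert, id, union_comm B, ← union_assoc, ← add_assoc]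
    have hchain := ih (hI.subset (subset_insert B I)) (by omega)
    have hB := hI.isRepairGroup B (mem_insert_self B I)
    obtain ⟨hcard, hTB⟩ := hT.card_eq_and_disjoint hj hB (hI.not_le B (mem_insert_self B I))
    have hIB : Disjoint (I.biUnion id) B := (disjoint_biUnion_left _ _ _).2 fun B' hB' ↦
      hI.pairwiseDisjoint (mem_insert_of_mem hB') (mem_insert_self B I)
        (ne_of_mem_of_not_mem hB' hBI)
    refine hchain.union hB fun hle ↦ ?_
    have hlt := hchain.card_lt_of_spanOn_le hnull hφ hu (by omega)
      (disjoint_union_left.2 ⟨hTB, hIB⟩) hle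
    omega

theorem le_card_compl_union_biUnion [Fintype ι] {v w : ℕ} (hT : IsSaturatedChain K φ r s u j T)
    (hj : j + 1 ≤ u) (hdef : j * (r + s) + v ≤ #T + r) (hv : 0 < v) (hms : m ≤ s)
    (hι : Fintype.card ι = w * (r + s) + m) (h𝓑 : IsRepairPacking K φ r s T 𝓑) :
    m ≤ #(T ∪ 𝓑.biUnion id)ᶜ := by
  have hB : ∀ B ∈ 𝓑, #B = r + s ∧ Disjoint T B := fun B hB ↦
    hT.card_eq_and_disjoint hj (h𝓑.isRepairGroup B hB) (h𝓑.not_le B hB)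
  have hcard : #(T ∪ 𝓑.biUnion id) = #T + #𝓑 * (r + s) := by
    have hdisj : Disjoint T (𝓑.biUnion id) :=
      (disjoint_biUnion_right _ _ _).2 fun B hB' ↦ (hB B hB').2
    rw [card_union_of_disjoint hdisj, card_biUnion h𝓑.pairwiseDisjoint]
    exact congrArg (#T + ·) (sum_const_nat fun B hB' ↦ (hB B hB').1)
  have hle := card_le_univ (T ∪ 𝓑.biUnion id)
  have hTle := hT.add_two_mul_card_le
  rw [card_compl, hcard, hι]
  rw [hcard, hι] at hle
  have hw : j + #𝓑 ≤ w := by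
    by_contra! hlt
    have := Nat.mul_le_mul_right (r + s) hlt
    rw [Nat.add_one_mul, Nat.add_mul] at this
    omega
  have := Nat.mul_le_mul_right (r + s) hw
  rw [Nat.add_mul] at this
  omega

end IsSaturatedChain

omit [DecidableEq ι] in
theorem not_nullityLT_of_hasLocality [Fintype ι] {v w : ℕ} (hφ : HasLocality K φ r s)
    (hι : Fintype.card ι = w * (r + s) + m) (hk : u * r + v ≤ Module.finrank K V)
    (hv : 0 < v) (hms : m ≤ s) (hu : 2 * (r - v) + max m 2 ≤ u) :
    ¬ NullityLT K φ (u * s + m) := by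
  classical
  intro hnull
  obtain ⟨j, T, hT⟩ := exists_isSaturatedChain K φ r s u
  obtain ⟨𝓑, h𝓑⟩ := exists_maximal_isRepairPacking K φ r s T
  have hj := hT.le_two_mul hnull hφ hv hms hk
  have hju : j + m ≤ u ∧ j + 2 ≤ u := by omega
  have hdef := hT.isRepairChain.mul_add_le_card_add hnull hφ hv hms hk (hT.le.trans u.le_succ)
  obtain ⟨X, hX, hXcard⟩ := exists_subset_card_eq
    (hT.le_card_compl_union_biUnion (by omega) hdef hv hms hι h𝓑.prop)
  choose I hI𝓑 hIcard hI using hT.exists_mem_spanOn_union_biUnion hju.2 hφ h𝓑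
  set J := X.biUnion I
  have hJ𝓑 : J ⊆ 𝓑 := biUnion_subset.2 fun i _ ↦ hI𝓑 i
  have hJcard : j + #J ≤ u := by
    have : #J ≤ #X * 1 := card_biUnion_le_card_mul X I 1 fun i _ ↦ hIcard i
    omega
  have hchain := hT.isRepairChain_union_biUnion (by omega) hnull hφ (by omega) hms
    (h𝓑.prop.subset hJ𝓑) hJcard
  refine (hchain.card_lt_of_spanOn_le hnull hφ (by omega) hJcard ?_ ?_).ne hXcard
  · exact (disjoint_left.2 fun i hi hiX ↦ mem_compl.1 (hX hiX)
      (union_subset_union_right (biUnion_subset_biUnion_of_subset_left id hJ𝓑) hi))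
  · exact spanOn_le_iff.2 fun i hi ↦ spanOn_mono (union_subset_union_right
      (biUnion_subset_biUnion_of_subset_left id (subset_biUnion_of_mem I hi))) (hI i)

end VectorFamily

section Codes

open Finset

variable {ι K : Type*} [Field K]

/-- The `i`-th symbol of a codeword, as a linear functional on the code `C`. The matroid of this
family is the matroid of the columns of a generator matrix of `C`. -/
def coordFunctional (C : Submodule K (ι → K)) (i : ι) : Module.Dual K C :=
  LinearMap.proj i ∘ₗ C.subtype

variable {C : Submodule K (ι → K)} {T : Finset ι} {l : ι}

theorem coordFunctional_mem_spanOn_iff_exists :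
    coordFunctional C l ∈ spanOn K (coordFunctional C) T ↔
      ∃ a : ι → K, ∀ c ∈ C, c l = ∑ i ∈ T, a i * c i := by
  rw [spanOn, Submodule.mem_span_image_finset_iff_exists_fun']
  refine exists_congr fun a ↦ ?_
  simp [LinearMap.ext_iff, coordFunctional, eq_comm]

theorem coordFunctional_mem_spanOn_of_forall
    (h : ∀ c ∈ C, (∀ i ∈ T, c i = 0) → c l = 0) :
    coordFunctional C l ∈ spanOn K (coordFunctional C) T := by
  have hker : ⨅ i : T, LinearMap.ker (coordFunctional C i) ≤
      LinearMap.ker (coordFunctional C l) := by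
    intro c hc
    simp only [Submodule.mem_iInf, LinearMap.mem_ker, Subtype.forall] at hc
    exact h c c.2 hc
  have hmem := mem_span_of_iInf_ker_le_ker hker
  rwa [Set.range_comp' (coordFunctional C) Subtype.val, Subtype.range_coe] at hmem

theorem IsRepairSet.isRepairGroup {r δ : ℕ} {A : Finset ι} (hA : IsRepairSet C r δ A)
    (hδ : 1 ≤ δ) : IsRepairGroup K (coordFunctional C) r (δ - 1) A := by
  refine ⟨hA.1.trans_eq (Nat.add_sub_assoc hδ r), fun L hLA hL ↦ spanOn_le_iff.2 fun l hl ↦ ?_⟩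
  by_cases hlL : l ∈ L
  · exact mem_spanOn hlL
  · exact coordFunctional_mem_spanOn_iff_exists.2 (hA.2 l hl L hLA hlL hL)

theorem span_range_coordFunctional [Finite ι] :
    Submodule.span K (Set.range (coordFunctional C)) = ⊤ := by
  refine Submodule.span_eq_top_of_ne_zero fun c hc ↦ ?_
  by_contra! hall
  exact hc (Subtype.ext (funext fun i ↦ hall _ (Set.mem_range_self i)))

theorem spanOn_coordFunctional_eq_top [Finite ι] (h : ∀ c ∈ C, (∀ i ∈ T, c i = 0) → c = 0) :
    spanOn K (coordFunctional C) T = ⊤ := by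
  rw [← top_le_iff, ← span_range_coordFunctional, Submodule.span_le, Set.range_subset_iff]
  exact fun l ↦ coordFunctional_mem_spanOn_of_forall fun c hc hT ↦ congrFun (h c hc hT) l

theorem HasAllSymbolLocality.hasLocality [Finite ι] {r δ : ℕ} (hC : HasAllSymbolLocality C r δ) :
    HasLocality K (coordFunctional C) r (δ - 1) where
  span_eq_top := span_range_coordFunctional
  exists_mem i := by
    obtain ⟨A, hA, hi⟩ := hC.2.2.2 i
    exact ⟨A, hA.isRepairGroup (one_le_two.trans hC.2.2.1), hi⟩

variable [Fintype ι]

theorem nullityLT_coordFunctional [DecidableEq K] {d e : ℕ} (hd : 0 < d)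
    (hC : ∀ c ∈ C, c ≠ 0 → d ≤ hammingNorm c)
    (he : Fintype.card ι + 1 < d + Module.finrank K C + e) :
    NullityLT K (coordFunctional C) e := by
  classical
  have htop : ∀ X : Finset ι, Fintype.card ι < #X + d → spanOn K (coordFunctional C) X = ⊤ := by
    refine fun X hX ↦ spanOn_coordFunctional_eq_top fun c hc hcX ↦ ?_
    by_contra hc0
    have hle : hammingNorm c ≤ #Xᶜ :=
      card_le_card fun i hi ↦ mem_compl.2 fun hiX ↦ (mem_filter.1 hi).2 (hcX i hiX)
    have := hC c hc hc0
    have := card_compl_add_card X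
    omega
  intro T hT
  have hTcard : #T + d ≤ Fintype.card ι := not_lt.1 (mt (htop T) hT)
  obtain ⟨X, hTX, hX⟩ := exists_superset_card_eq (s := T) (n := Fintype.card ι + 1 - d)
    (by omega) (by omega)
  have hrank := rankOn_union_le (K := K) (φ := coordFunctional C) T X
  rw [union_eq_right.2 hTX, rankOn, htop X (by omega), finrank_top, Subspace.dual_finrank_eq]
    at hrank
  have := card_sdiff_add_card_eq_card hTX
  omega

theorem exists_isLinearCodeWithParams (hC : C ≠ ⊥) :
    ∃ d, IsLinearCodeWithParams C (Fintype.card ι) (Module.finrank K C) d := by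
  classical
  obtain ⟨x, hx, hx0⟩ := Submodule.exists_mem_ne_zero_of_ne_bot hC
  exact ⟨_, rfl, rfl, isLeast_csInf ⟨_, x, hx, 0, C.zero_mem, hx0, rfl⟩⟩

namespace IsLinearCodeWithParams

variable {n k d : ℕ}

theorem le_hammingNorm [DecidableEq K] (hC : IsLinearCodeWithParams C n k d) {c : ι → K}
    (hc : c ∈ C) (hc0 : c ≠ 0) : d ≤ hammingNorm c := by
  have hle : d ≤ hammingDist c 0 := hC.2.2.2 ⟨c, hc, 0, C.zero_mem, hc0, by congr!⟩
  rwa [hammingDist_zero_right] at hle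

theorem exists_hammingNorm_eq [DecidableEq K] (hC : IsLinearCodeWithParams C n k d) :
    ∃ c ∈ C, c ≠ 0 ∧ hammingNorm c = d := by
  obtain ⟨x, hx, y, hy, hxy, rfl⟩ := hC.2.2.1
  refine ⟨-x + y, C.add_mem (C.neg_mem hx) hy, mt neg_add_eq_zero.1 hxy, ?_⟩
  rw [← hammingDist_eq_hammingNorm]
  congr!

theorem minDist_pos (hC : IsLinearCodeWithParams C n k d) : 0 < d := by
  classical
  obtain ⟨x, -, y, -, hxy, rfl⟩ := hC.2.2.1
  exact hammingDist_pos.2 hxy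

theorem eq_zero_of_card_lt (hC : IsLinearCodeWithParams C n k d) {D : Finset ι} (hD : #D < d)
    {c : ι → K} (hc : c ∈ C) (hcD : ∀ i ∉ D, c i = 0) : c = 0 := by
  classical
  by_contra hc0
  have hle : hammingNorm c ≤ #D :=
    card_le_card fun i hi ↦ not_imp_comm.1 (hcD i) (mem_filter.1 hi).2
  exact (hle.trans_lt hD).not_ge (hC.le_hammingNorm hc hc0)

theorem add_finrank_add_le {w u r v δ m : ℕ} (hC : IsLinearCodeWithParams C n k d)
    (hloc : HasAllSymbolLocality C r δ) (hn : n = w * (r + δ - 1) + m) (hk : u * r + v ≤ k)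
    (hv : 0 < v) (hmδ : m ≤ δ - 1) (hu : 2 * (r - v) + max m 2 ≤ u) :
    d + k + (u * (δ - 1) + m) ≤ n + 1 := by
  classical
  by_contra! hlt
  have hδ := hloc.2.2.1
  refine not_nullityLT_of_hasLocality (w := w) (v := v) (u := u) hloc.hasLocality ?_ ?_ hv hmδ hu
    (nullityLT_coordFunctional hC.minDist_pos (fun c hc hc0 ↦ hC.le_hammingNorm hc hc0) ?_)
  · rw [hC.1, hn, Nat.add_sub_assoc (by omega)]
  · rwa [Subspace.dual_finrank_eq, hC.2.1]
  · rwa [hC.1, hC.2.1]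

end IsLinearCodeWithParams

theorem card_le_finrank_parityCheckCode_add_card {ρ : Type*} [Fintype ρ] (H : Matrix ρ ι K) :
    Fintype.card ι ≤ Module.finrank K (parityCheckCode H) + Fintype.card ρ := by
  have hadd := LinearMap.finrank_range_add_finrank_ker H.mulVecLin
  have hle := Submodule.finrank_le (LinearMap.range H.mulVecLin)
  rw [Module.finrank_fintype_fun_eq_card] at hadd hle
  rw [parityCheckCode]
  omega

end Codes

section Moore

open Polynomial

variable {F L : Type*} [Field F] [Fintype F] [Field L] [Algebra F L]

theorem sum_smul_pow_card_pow {κ : Type*} (s : Finset κ) (x : κ → F) (β : κ → L) (i : ℕ) :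
    (∑ j ∈ s, x j • β j) ^ Fintype.card F ^ i = ∑ j ∈ s, x j • β j ^ Fintype.card F ^ i := by
  have hfrob : ∀ y : L, (FiniteField.frobeniusAlgHom F L ^ i) y = y ^ Fintype.card F ^ i := by
    intro y
    rw [AlgHom.coe_pow, FiniteField.coe_frobeniusAlgHom, pow_iterate]
  simp_rw [← hfrob, map_sum, map_smul]

/-- The `q`-polynomial with coefficients `a`, used to show that Moore matrices are nonsingular. -/
noncomputable def linearizedPolynomial (q : ℕ) {N : ℕ} (a : Fin N → L) : L[X] :=
  ∑ i, C (a i) * X ^ q ^ (i : ℕ)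

variable {q N : ℕ}

theorem coeff_linearizedPolynomial (hq : 1 < q) (a : Fin N → L) (i : Fin N) :
    (linearizedPolynomial q a).coeff (q ^ (i : ℕ)) = a i := by
  simp [linearizedPolynomial, finsetSum_coeff, coeff_X_pow, (Nat.pow_right_injective hq).eq_iff,
    Fin.val_inj]

theorem natDegree_linearizedPolynomial_lt (hq : 1 < q) (a : Fin N → L) :
    (linearizedPolynomial q a).natDegree < q ^ N := by
  have hpos : 0 < q ^ N := pow_pos (by omega) N
  have hle : (linearizedPolynomial q a).natDegree ≤ q ^ N - 1 :=
    natDegree_sum_le_of_forall_le _ _ fun i _ ↦ (natDegree_C_mul_X_pow_le _ _).trans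
      (Nat.le_sub_one_of_lt (Nat.pow_lt_pow_right hq i.2))
  omega

theorem eval_linearizedPolynomial (a : Fin N → L) (y : L) :
    (linearizedPolynomial q a).eval y = ∑ i, a i * y ^ q ^ (i : ℕ) := by
  simp [linearizedPolynomial, eval_finsetSum]

theorem eval_linearizedPolynomial_sum_smul {κ : Type*} (s : Finset κ) (a : Fin N → L) (x : κ → F)
    (β : κ → L) :
    (linearizedPolynomial (Fintype.card F) a).eval (∑ j ∈ s, x j • β j) =
      ∑ j ∈ s, x j • (linearizedPolynomial (Fintype.card F) a).eval (β j) := by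
  simp_rw [eval_linearizedPolynomial, sum_smul_pow_card_pow, Finset.mul_sum, Finset.smul_sum,
    mul_smul_comm]
  exact Finset.sum_comm

theorem det_mooreMatrix_ne_zero {β : Fin N → L} (hβ : LinearIndependent F β) :
    (mooreMatrix (Fintype.card F) N β).det ≠ 0 := by
  intro hdet
  obtain ⟨a, ha, haM⟩ := Matrix.exists_vecMul_eq_zero_iff.2 hdet
  have hq : 1 < Fintype.card F := Fintype.one_lt_card
  have hroot : ∀ j, (linearizedPolynomial (Fintype.card F) a).eval (β j) = 0 := fun j ↦
    (eval_linearizedPolynomial a (β j)).trans (congrFun haM j)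
  have hzero : linearizedPolynomial (Fintype.card F) a = 0 := by
    refine eq_zero_of_natDegree_lt_card_of_eval_eq_zero _
      (linearIndependent_iff_injective_fintypeLinearCombination.1 hβ) (fun x ↦ ?_) ?_
    · simp [Fintype.linearCombination_apply, eval_linearizedPolynomial_sum_smul, hroot]
    · simpa using natDegree_linearizedPolynomial_lt hq a
  refine ha (funext fun i ↦ ?_)
  rw [← coeff_linearizedPolynomial hq a i, hzero, coeff_zero, Pi.zero_apply]

theorem eq_zero_of_mooreMatrix_mulVec_eq_zero {h : ℕ} (hN : N ≤ h) {β c : Fin N → L}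
    (hβ : LinearIndependent F β) (hc : (mooreMatrix (Fintype.card F) h β).mulVec c = 0) : c = 0 :=
  Matrix.eq_zero_of_mulVec_eq_zero (det_mooreMatrix_ne_zero hβ)
    (funext fun i ↦ congrFun hc (Fin.castLE hN i))

end Moore

section ScalarExtension

variable {ι F : Type*} (L : Type*) [Field F] [Field L] [Algebra F L]

/-- The extension of scalars `L ⊗ W` of the code `W`, inside `ι → L`: the words all of whose images
under `F`-linear functionals on `L` lie in `W`. -/
def scalarExtension (W : Submodule F (ι → F)) : Submodule L (ι → L) where
  carrier := {c | ∀ f : Module.Dual F L, f ∘ c ∈ W}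
  zero_mem' f := by
    convert W.zero_mem
    ext
    simp
  add_mem' {c c'} hc hc' f := by
    convert W.add_mem (hc f) (hc' f)
    ext
    simp
  smul_mem' a c hc f := hc (f ∘ₗ LinearMap.mulLeft F a)

variable {L} {W : Submodule F (ι → F)} {c : ι → L}

theorem eq_of_forall_dual_apply_eq {y z : L} (h : ∀ f : Module.Dual F L, f y = f z) : y = z :=
  sub_eq_zero.1 ((Module.forall_dual_apply_eq_zero_iff F _).1 fun f ↦ by
    rw [map_sub, h, sub_self])

theorem eq_sum_of_mem_scalarExtension (hc : c ∈ scalarExtension L W) {T : Finset ι} {l : ι}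
    {a : ι → F} (ha : ∀ x ∈ W, x l = ∑ i ∈ T, a i * x i) :
    c l = ∑ i ∈ T, algebraMap F L (a i) * c i := by
  refine eq_of_forall_dual_apply_eq (F := F) fun f ↦ ?_
  simpa [← Algebra.smul_def] using ha (f ∘ c) (hc f)

theorem exists_eq_sum_smul_of_mem_scalarExtension [Finite ι] (hc : c ∈ scalarExtension L W)
    {κ : Type*} [Fintype κ] (b : Module.Basis κ F W) :
    ∃ y : κ → L, ∀ j, c j = ∑ l, (b l : ι → F) j • y l := by
  classical
  have := Fintype.ofFinite ι
  obtain ⟨p, hp⟩ := LinearMap.exists_leftInverse_of_injective W.subtype W.ker_subtype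
  let g (l : κ) : (ι → F) →ₗ[F] F := b.coord l ∘ₗ p
  refine ⟨fun l ↦ ∑ i, g l (fun j ↦ if i = j then 1 else 0) • c i, fun j ↦
    eq_of_forall_dual_apply_eq (F := F) fun f ↦ ?_⟩
  have hcoord : ∀ l, f (∑ i, g l (fun j ↦ if i = j then 1 else 0) • c i) =
      b.repr ⟨f ∘ c, hc f⟩ l := by
    intro l
    have hg : g l (f ∘ c) = b.repr ⟨f ∘ c, hc f⟩ l :=
      congrArg (b.coord l) (LinearMap.congr_fun hp ⟨f ∘ c, hc f⟩)
    rw [← hg, LinearMap.pi_apply_eq_sum_univ (g l)]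
    simp [mul_comm]
  have hsum : (∑ l, b.repr ⟨f ∘ c, hc f⟩ l • b l : W).1 j = f (c j) := by
    rw [b.sum_repr]
    rfl
  simp only [map_sum, map_smul, hcoord, ← hsum, AddSubmonoidClass.coe_finsetSum,
    Finset.sum_apply, SetLike.val_smul, Pi.smul_apply, smul_eq_mul, mul_comm]

variable [Fintype ι]

theorem parityCheckCode_map_le_scalarExtension {ρ : Type*} (H : Matrix ρ ι F) :
    parityCheckCode (H.map (algebraMap F L)) ≤ scalarExtension L (parityCheckCode H) := by
  intro c hc f
  ext i
  have hi : ∑ j, algebraMap F L (H i j) * c j = 0 := congrFun hc i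
  simpa [← Algebra.smul_def, Matrix.mulVec, dotProduct] using congrArg f hi

theorem eq_zero_of_mem_scalarExtension_of_mooreMatrix [Fintype F] {h : ℕ} {α : ι → L}
    (hW : Module.finrank F W ≤ h) (hα : ∀ x ∈ W, ∑ j, x j • α j = 0 → x = 0)
    (hc : c ∈ scalarExtension L W) (hM : (mooreMatrix (Fintype.card F) h α).mulVec c = 0) :
    c = 0 := by
  let b := Module.finBasis F W
  obtain ⟨y, hy⟩ := exists_eq_sum_smul_of_mem_scalarExtension hc b
  let β l := ∑ j, (b l : ι → F) j • α j
  have hβ : LinearIndependent F β := by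
    have hker : LinearMap.ker (Fintype.linearCombination F α ∘ₗ W.subtype) = ⊥ :=
      LinearMap.ker_eq_bot'.2 fun x hx ↦ Subtype.ext (hα x x.2 hx)
    exact b.linearIndependent.map' _ hker
  have hMβ : (mooreMatrix (Fintype.card F) h β).mulVec y = 0 := by
    rw [← hM]
    ext i
    simp only [Matrix.mulVec, dotProduct, mooreMatrix, Matrix.of_apply, β, sum_smul_pow_card_pow,
      hy, Finset.sum_mul, Finset.mul_sum, smul_mul_assoc, mul_smul_comm]
    exact Finset.sum_comm
  have hy0 := eq_zero_of_mooreMatrix_mulVec_eq_zero hW hβ hMβ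
  ext j
  simp [hy j, hy0]

end ScalarExtension

section BlockCodes

open Finset

variable {ι B F : Type*} [Field F]

/-- On each block `{i | blk i = b}` the code `W` has minimum distance greater than `e b`: a codeword
that vanishes on the block outside a set `D` of at most `e b` coordinates vanishes on the block. -/
def HasBlockDistance (W : Submodule F (ι → F)) (blk : ι → B) (e : B → ℕ) : Prop :=
  ∀ x ∈ W, ∀ b, ∀ D : Finset ι, #D ≤ e b → (∀ i ∉ D, blk i = b → x i = 0) →
    ∀ i, blk i = b → x i = 0

/-- The subcode of the codewords of `W` that vanish outside `T`. -/
def supportedSubcode (W : Submodule F (ι → F)) (T : Finset ι) : Submodule F (ι → F) where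
  carrier := {x | x ∈ W ∧ ∀ i ∉ T, x i = 0}
  zero_mem' := ⟨W.zero_mem, fun _ _ ↦ rfl⟩
  add_mem' hx hy := ⟨W.add_mem hx.1 hy.1, fun i hi ↦ by simp [hx.2 i hi, hy.2 i hi]⟩
  smul_mem' a _ hx := ⟨W.smul_mem a hx.1, fun i hi ↦ by simp [hx.2 i hi]⟩

variable {W : Submodule F (ι → F)} {blk : ι → B} {e : B → ℕ} {T : Finset ι}

theorem mem_scalarExtension_supportedSubcode {L : Type*} [Field L] [Algebra F L] {c : ι → L}
    (hc : c ∈ scalarExtension L W) (hT : ∀ i ∉ T, c i = 0) :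
    c ∈ scalarExtension L (supportedSubcode W T) :=
  fun f ↦ ⟨hc f, fun i hi ↦ by simp [hT i hi]⟩

theorem sum_tsub_le_of_sum_le [Fintype B] {x : B → ℕ} {s r h N : ℕ} (he : ∀ b, s ≤ e b)
    (hx : ∀ b, x b ≤ r + e b) (hN : (N - 1) * r ≤ h) (hsum : ∑ b, x b ≤ h + N * s) :
    ∑ b, (x b - e b) ≤ h := by
  let J : Finset B := {b | e b < x b}
  have hJ : ∑ b, (x b - e b) = ∑ b ∈ J, (x b - e b) :=
    (sum_subset (subset_univ J) fun b _ hb ↦ by simpa [J, Nat.sub_eq_zero_iff_le] using hb).symm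
  rw [hJ]
  obtain hJN | hJN := le_or_gt N #J
  · have hsplit : ∑ b ∈ J, (x b - e b) + ∑ b ∈ J, e b = ∑ b ∈ J, x b := by
      rw [← sum_add_distrib]
      exact sum_congr rfl fun b hb ↦ Nat.sub_add_cancel (mem_filter.1 hb).2.le
    have hxJ : ∑ b ∈ J, x b ≤ ∑ b, x b := sum_le_sum_of_subset (subset_univ J)
    have heJ : N * s ≤ ∑ b ∈ J, e b :=
      (Nat.mul_le_mul_right s hJN).trans (card_nsmul_le_sum J e s fun b _ ↦ he b)
    omega
  · have hle : ∑ b ∈ J, (x b - e b) ≤ #J * r :=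
      sum_le_card_nsmul J _ r fun b _ ↦ Nat.sub_le_iff_le_add.2 (hx b)
    exact hle.trans ((Nat.mul_le_mul_right r (by omega)).trans hN)

variable [DecidableEq B]

theorem HasBlockDistance.isRepairSet [Fintype ι] {L : Type*} [Field L] [Algebra F L]
    (hW : HasBlockDistance W blk e) {r δ : ℕ} {b : B} (hδ : 1 ≤ δ) (hb : #{i | blk i = b} ≤ r + e b)
    {C : Submodule L (ι → L)} (hC : C ≤ scalarExtension L W) {A : Finset ι}
    (hA : ∀ i ∈ A, blk i = b) (hAcard : #A = r + (δ - 1)) : IsRepairSet C r δ A := by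
  classical
  refine ⟨by omega, fun l hl T hTA _ hT ↦ ?_⟩
  obtain ⟨a, ha⟩ := coordFunctional_mem_spanOn_iff_exists.1 <|
    coordFunctional_mem_spanOn_of_forall (C := W) (T := T) (l := l) fun x hx hxT ↦ by
      have hTb : T ⊆ ({i | blk i = b} : Finset ι) := fun i hi ↦ by simpa using hA i (hTA hi)
      refine hW x hx b (({i | blk i = b} : Finset ι) \ T) ?_ (fun i hi hib ↦ ?_) l (hA l hl)
      · rw [card_sdiff_of_subset hTb]
        omega
      · exact hxT i (by simpa [hib] using hi)
  exact ⟨_, fun c hc ↦ eq_sum_of_mem_scalarExtension (hC hc) ha⟩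

theorem exists_card_le_sum_tsub [Fintype B] [DecidableEq ι] (blk : ι → B) (e : B → ℕ)
    (T : Finset ι) : ∃ R, #R ≤ ∑ b, (#{i ∈ T | blk i = b} - e b) ∧
      ∀ b, #{i ∈ T \ R | blk i = b} ≤ e b := by
  choose R hRT hR using fun b ↦
    exists_subset_card_eq (Nat.sub_le #{i ∈ T | blk i = b} (e b))
  refine ⟨univ.biUnion R, card_biUnion_le.trans_eq (sum_congr rfl fun b _ ↦ hR b), fun b ↦ ?_⟩
  have hsub : ({i ∈ T \ univ.biUnion R | blk i = b} : Finset ι) ⊆ {i ∈ T | blk i = b} \ R b := by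
    intro i
    simp only [mem_filter, mem_sdiff, mem_biUnion, mem_univ, true_and, not_exists]
    exact fun ⟨⟨hiT, hiR⟩, hib⟩ ↦ ⟨⟨hiT, hib⟩, hiR b⟩
  have hle := card_le_card hsub
  rw [card_sdiff_of_subset (hRT b), hR b] at hle
  omega

theorem HasBlockDistance.finrank_supportedSubcode_le [Fintype B] (hW : HasBlockDistance W blk e)
    (T : Finset ι) :
    Module.finrank F (supportedSubcode W T) ≤ ∑ b, (#{i ∈ T | blk i = b} - e b) := by
  classical
  obtain ⟨R, hRcard, hR⟩ := exists_card_le_sum_tsub blk e T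
  let restrict : supportedSubcode W T →ₗ[F] R → F :=
    LinearMap.funLeft F F Subtype.val ∘ₗ (supportedSubcode W T).subtype
  have hinj : Function.Injective restrict := by
    rw [injective_iff_map_eq_zero]
    rintro ⟨x, hxW, hxT⟩ hx
    have hxR : ∀ i ∈ R, x i = 0 := fun i hi ↦ congrFun hx ⟨i, hi⟩
    refine Subtype.ext (funext fun i ↦
      hW x hxW (blk i) {j ∈ T \ R | blk j = blk i} (hR _) (fun j hj hji ↦ ?_) i rfl)
    by_cases hjT : j ∈ T
    · exact hxR j (by simpa [hjT, hji] using hj)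
    · exact hxT j hjT
  refine (LinearMap.finrank_le_finrank_of_injective hinj).trans ?_
  rwa [Module.finrank_fintype_fun_eq_card, Fintype.card_coe]

theorem HasBlockDistance.eq_zero_of_mooreMatrix [Fintype F] [Fintype ι] [Finite B] {L : Type*}
    [Field L] [Algebra F L] (hW : HasBlockDistance W blk e) {s r h N : ℕ} (he : ∀ b, s ≤ e b)
    (hblk : ∀ b, #{i | blk i = b} ≤ r + e b) (hN : (N - 1) * r ≤ h) (hT : #T ≤ h + N * s)
    {α c : ι → L} (hα : LinearIndepOn F α T) (hc : c ∈ scalarExtension L W)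
    (hM : (mooreMatrix (Fintype.card F) h α).mulVec c = 0) (hcT : ∀ i ∉ T, c i = 0) : c = 0 := by
  have := Fintype.ofFinite B
  have hrank : Module.finrank F (supportedSubcode W T) ≤ h := by
    refine (hW.finrank_supportedSubcode_le T).trans (sum_tsub_le_of_sum_le he (fun b ↦ ?_) hN ?_)
    · exact (card_le_card (filter_subset_filter _ (subset_univ T))).trans (hblk b)
    · rwa [sum_card_fiberwise_eq_card_filter, filter_true_of_mem (by simp)]
  refine eq_zero_of_mem_scalarExtension_of_mooreMatrix hrank (fun x hx hxα ↦ ?_)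
    (mem_scalarExtension_supportedSubcode hc hcT) hM
  have hsum : ∑ i ∈ T, x i • α i = 0 := by
    rw [← hxα]
    exact sum_subset (subset_univ T) fun i _ hi ↦ by rw [hx.2 i hi, zero_smul]
  ext i
  by_cases hi : i ∈ T
  · exact linearIndepOn_finset_iff.1 hα x hsum i hi
  · exact hx.2 i hi

theorem IsWiseIndependent.linearIndepOn {L : Type*} [Field L] [Algebra F L] {α : ι → L}
    (hα : Function.Injective α) {t : ℕ} (hS : IsWiseIndependent F (Set.range α) t) (hT : #T ≤ t) :
    LinearIndepOn F α T := by
  classical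
  have hind := hS (T.image α) (by simp) (card_image_le.trans hT)
  exact hind.comp (fun j : T ↦ (⟨α j, mem_image_of_mem α j.2⟩ : T.image α))
    fun i j hij ↦ Subtype.ext (hα (Subtype.ext_iff.1 hij))

end BlockCodes

section Construction

open Finset

variable {ρ₁ ρ₂ κ₁ κ₂ B F L : Type*}

/-- The block of a coordinate of the construction: `none` for the block `κ₁` of `P₁`, and `some b`
for the `b`-th of the blocks `κ₂` of `P₂`. -/
def blockIndex : κ₁ ⊕ κ₂ × B → Option B :=
  Sum.elim (fun _ ↦ none) fun p ↦ some p.2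

/-- The number of erasures that each block of the construction corrects: `e₁` for the first block
and `e₂` for each of the others. -/
def blockRedundancy (e₁ e₂ : ℕ) : Option B → ℕ :=
  fun b ↦ b.elim e₁ fun _ ↦ e₂

section Blocks

variable [Fintype κ₁] [Fintype κ₂] [Fintype B]

theorem card_blockIndex_eq_none :
    #{i : κ₁ ⊕ κ₂ × B | blockIndex i = none} = Fintype.card κ₁ := by
  rw [card_filter, Fintype.sum_sum_type]
  simp [blockIndex]

variable [DecidableEq B]

theorem card_blockIndex_eq_some (b : B) :
    #{i : κ₁ ⊕ κ₂ × B | blockIndex i = some b} = Fintype.card κ₂ := by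
  rw [card_filter, Fintype.sum_sum_type, Fintype.sum_prod_type]
  simp [blockIndex]

variable [Field F] [Field L] [Algebra F L] {P₁ : Matrix ρ₁ κ₁ F} {P₂ : Matrix ρ₂ κ₂ F}

theorem mem_parityCheckCode_fromBlocks {c : κ₁ ⊕ κ₂ × B → F} :
    c ∈ parityCheckCode (Matrix.fromBlocks P₁ 0 0 (Matrix.blockDiagonal fun _ : B ↦ P₂)) ↔
      c ∘ Sum.inl ∈ parityCheckCode P₁ ∧
        ∀ b, (fun x ↦ c (Sum.inr (x, b))) ∈ parityCheckCode P₂ := by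
  have hdiag : ∀ x b, (Matrix.blockDiagonal fun _ : B ↦ P₂).mulVec (c ∘ Sum.inr) (x, b) =
      P₂.mulVec (fun y ↦ c (Sum.inr (y, b))) x := by
    simp [Matrix.mulVec, dotProduct, Matrix.blockDiagonal_apply, Fintype.sum_prod_type, ite_mul]
  simp only [parityCheckCode, LinearMap.mem_ker, Matrix.mulVecLin_apply, Matrix.fromBlocks_mulVec,
    Matrix.zero_mulVec, add_zero, zero_add, funext_iff, Sum.forall, Sum.elim_inl, Sum.elim_inr,
    Prod.forall, hdiag, Pi.zero_apply]
  exact and_congr_right fun _ ↦ forall_comm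

theorem hasBlockDistance_parityCheckCode_fromBlocks {n₁ k₁ d₁ n₂ k₂ d₂ e₁ e₂ : ℕ}
    (hP₁ : IsLinearCodeWithParams (parityCheckCode P₁) n₁ k₁ d₁) (he₁ : e₁ < d₁)
    (hP₂ : IsLinearCodeWithParams (parityCheckCode P₂) n₂ k₂ d₂) (he₂ : e₂ < d₂) :
    HasBlockDistance
      (parityCheckCode (Matrix.fromBlocks P₁ 0 0 (Matrix.blockDiagonal fun _ : B ↦ P₂)))
      blockIndex (blockRedundancy e₁ e₂) := by
  intro c hc b D hD hcD i hi
  rw [mem_parityCheckCode_fromBlocks] at hc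
  obtain x | ⟨x, b'⟩ := i <;> subst hi
  · have hcard := card_le_card_of_injOn (s := D.preimage _ Sum.inl_injective.injOn) _
      (fun y hy ↦ mem_preimage.1 hy) Sum.inl_injective.injOn
    refine congrFun (hP₁.eq_zero_of_card_lt ((hcard.trans hD).trans_lt he₁) hc.1 fun y hy ↦ ?_) x
    exact hcD _ (mt mem_preimage.2 hy) rfl
  · have hinj : Function.Injective fun y : κ₂ ↦ (Sum.inr (y, b') : κ₁ ⊕ κ₂ × B) :=
      fun y z hyz ↦ by simpa using hyz
    have hcard := card_le_card_of_injOn (s := D.preimage _ hinj.injOn) _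
      (fun y hy ↦ mem_preimage.1 hy) hinj.injOn
    refine congrFun (hP₂.eq_zero_of_card_lt ((hcard.trans hD).trans_lt he₂) (hc.2 b')
      fun y hy ↦ ?_) x
    exact hcD (Sum.inr (y, b')) (fun hyD ↦ hy (mem_preimage.2 hyD)) rfl

end Blocks

variable [Field F] [Fintype F] [Field L] [Algebra F L] {w u r v δ m h : ℕ}
  {P₁ : Matrix (Fin (m + δ - 1)) (Fin (m + r + δ - 1)) F}
  {P₂ : Matrix (Fin (δ - 1)) (Fin (r + δ - 1)) F} {α : BlockCoord w r δ m → L}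

theorem card_blockIndex_blockCoord (hδ : 1 ≤ δ) (b : Option (Fin (w - 1))) :
    #{i : BlockCoord w r δ m | blockIndex i = b} =
      r + blockRedundancy (m + (δ - 1)) (δ - 1) b := by
  cases b with
  | none =>
    rw [card_blockIndex_eq_none, Fintype.card_fin, blockRedundancy, Option.elim_none]
    omega
  | some b =>
    rw [card_blockIndex_eq_some, Fintype.card_fin, blockRedundancy, Option.elim_some]
    omega

theorem card_blockCoord (hw : 1 ≤ w) (hδ : 1 ≤ δ) :
    Fintype.card (BlockCoord w r δ m) = w * (r + (δ - 1)) + m := by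
  obtain ⟨w, rfl⟩ := Nat.exists_eq_add_of_le' hw
  simp only [Fintype.card_sum, Fintype.card_prod, Fintype.card_fin, Nat.add_sub_cancel]
  rw [add_one_mul, Nat.add_sub_assoc hδ, Nat.add_sub_assoc hδ, mul_comm w]
  omega

theorem le_finrank_blockParityCheck {k : ℕ} (hw : 1 ≤ w) (hδ : 1 ≤ δ) (hk : h + k = w * r)
    (P₁ : Matrix (Fin (m + δ - 1)) (Fin (m + r + δ - 1)) F)
    (P₂ : Matrix (Fin (δ - 1)) (Fin (r + δ - 1)) F) (α : BlockCoord w r δ m → L) :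
    k ≤ Module.finrank L (parityCheckCode (blockParityCheck h P₁ P₂ α)) := by
  have hcard := card_le_finrank_parityCheckCode_add_card (blockParityCheck h P₁ P₂ α)
  rw [card_blockCoord hw hδ] at hcard
  simp only [Fintype.card_sum, Fintype.card_prod, Fintype.card_fin] at hcard
  obtain ⟨w', hw'⟩ := Nat.exists_eq_add_of_le' hw
  have hrows : m + δ - 1 + (δ - 1) * (w - 1) + h + k = w * (r + (δ - 1)) + m := by
    rw [mul_add, ← hk, hw', Nat.add_sub_cancel, mul_comm (δ - 1), add_one_mul w']
    omega
  omega

theorem mem_parityCheckCode_blockParityCheck {c : BlockCoord w r δ m → L} :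
    c ∈ parityCheckCode (blockParityCheck h P₁ P₂ α) ↔
      c ∈ parityCheckCode ((Matrix.fromBlocks P₁ 0 0
        (Matrix.blockDiagonal fun _ : Fin (w - 1) ↦ P₂)).map (algebraMap F L)) ∧
      (mooreMatrix (Fintype.card F) h α).mulVec c = 0 := by
  rw [Matrix.fromBlocks_map, Matrix.blockDiagonal_map _ _ (map_zero _),
    Matrix.map_zero _ (map_zero _), Matrix.map_zero _ (map_zero _)]
  simp only [parityCheckCode, LinearMap.mem_ker, Matrix.mulVecLin_apply, blockParityCheck,
    Matrix.fromRows_mulVec, funext_iff, Sum.forall, Sum.elim_inl, Sum.elim_inr, Pi.zero_apply]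

theorem parityCheckCode_blockParityCheck_le_scalarExtension :
    parityCheckCode (blockParityCheck h P₁ P₂ α) ≤ scalarExtension L (parityCheckCode
      (Matrix.fromBlocks P₁ 0 0 (Matrix.blockDiagonal fun _ : Fin (w - 1) ↦ P₂))) :=
  fun _ hc ↦ parityCheckCode_map_le_scalarExtension _ (mem_parityCheckCode_blockParityCheck.1 hc).1

theorem hasAllSymbolLocality_blockParityCheck (hδ : 2 ≤ δ) (hr : 1 ≤ r)
    (hP₁ : IsLinearCodeWithParams (parityCheckCode P₁) (m + r + δ - 1) r (m + δ))
    (hP₂ : IsLinearCodeWithParams (parityCheckCode P₂) (r + δ - 1) r δ)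
    (hk : r ≤ Module.finrank L (parityCheckCode (blockParityCheck h P₁ P₂ α))) :
    HasAllSymbolLocality (parityCheckCode (blockParityCheck h P₁ P₂ α)) r δ := by
  refine ⟨hr, hk, hδ, fun i ↦ ?_⟩
  have hblk := card_blockIndex_blockCoord (w := w) (r := r) (m := m) (one_le_two.trans hδ)
    (blockIndex i)
  have hred : δ - 1 ≤ blockRedundancy (m + (δ - 1)) (δ - 1) (blockIndex i) := by
    cases blockIndex i <;> simp [blockRedundancy]
  obtain ⟨A, hiA, hA, hAcard⟩ := exists_subsuperset_card_eq (n := r + (δ - 1))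
    (t := {j : BlockCoord w r δ m | blockIndex j = blockIndex i}) (s := {i}) (by simp)
    (by rw [card_singleton]; omega) (by omega)
  refine ⟨A, ?_, singleton_subset_iff.1 hiA⟩
  exact (hasBlockDistance_parityCheckCode_fromBlocks hP₁ (by omega) hP₂ (by omega)).isRepairSet
    (one_le_two.trans hδ) hblk.le parityCheckCode_blockParityCheck_le_scalarExtension
    (fun j hj ↦ (mem_filter.1 (hA hj)).2) hAcard

theorem le_hammingNorm_of_mem_blockParityCheck [DecidableEq L] {N : ℕ} (hδ : 1 ≤ δ)
    (hP₁ : IsLinearCodeWithParams (parityCheckCode P₁) (m + r + δ - 1) r (m + δ))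
    (hP₂ : IsLinearCodeWithParams (parityCheckCode P₂) (r + δ - 1) r δ)
    (hα : Function.Injective α) (hN : (N - 1) * r ≤ h)
    (hS : IsWiseIndependent F (Set.range α) (h + N * (δ - 1))) {c : BlockCoord w r δ m → L}
    (hc : c ∈ parityCheckCode (blockParityCheck h P₁ P₂ α)) (hc0 : c ≠ 0) :
    h + N * (δ - 1) + 1 ≤ hammingNorm c := by
  by_contra! hlt
  have hsupp : #{i | c i ≠ 0} ≤ h + N * (δ - 1) := Nat.lt_succ_iff.1 hlt
  have hred : ∀ b : Option (Fin (w - 1)), δ - 1 ≤ blockRedundancy (m + (δ - 1)) (δ - 1) b :=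
    fun b ↦ by cases b <;> simp [blockRedundancy]
  refine hc0 ((hasBlockDistance_parityCheckCode_fromBlocks hP₁ (by omega) hP₂
    (by omega)).eq_zero_of_mooreMatrix hred (fun b ↦ (card_blockIndex_blockCoord hδ b).le) hN hsupp
    (hS.linearIndepOn hα hsupp) (parityCheckCode_blockParityCheck_le_scalarExtension hc)
    (mem_parityCheckCode_blockParityCheck.1 hc).2 fun i hi ↦ by simpa using hi)

theorem isLinearCodeWithParams_and_hasAllSymbolLocality_blockParityCheck {n k : ℕ}
    (hn : n = w * (r + δ - 1) + m) (hk : k = u * r + v) (hhk : h + k = w * r) (hδ : 2 ≤ δ)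
    (hv : 0 < v) (hvr : v ≤ r) (hmδ : m ≤ δ - 1) (hu : 2 * (r - v) + max m 2 ≤ u)
    (hP₁ : IsLinearCodeWithParams (parityCheckCode P₁) (m + r + δ - 1) r (m + δ))
    (hP₂ : IsLinearCodeWithParams (parityCheckCode P₂) (r + δ - 1) r δ)
    (hα : Function.Injective α)
    (hS : IsWiseIndependent F (Set.range α) (h + (w - u) * (δ - 1))) :
    IsLinearCodeWithParams (parityCheckCode (blockParityCheck h P₁ P₂ α))
        n k (h + (w - u) * (δ - 1) + 1) ∧
      HasAllSymbolLocality (parityCheckCode (blockParityCheck h P₁ P₂ α)) r δ := by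
  classical
  set C := parityCheckCode (blockParityCheck h P₁ P₂ α)
  have huw : u < w := lt_of_mul_lt_mul_right' (a := r) (by omega)
  have hsplit : ∀ a, w * a = u * a + (w - u) * a := fun a ↦ by
    rw [← add_mul, Nat.add_sub_of_le huw.le]
  have hN : (w - u - 1) * r ≤ h := by
    rw [Nat.sub_one_mul]
    have := hsplit r
    omega
  have hkC : k ≤ Module.finrank L C := le_finrank_blockParityCheck (by omega) (by omega) hhk P₁ P₂ α
  have hrk : r ≤ k := by
    have := Nat.le_mul_of_pos_left r (show 0 < u by omega)
    omega
  have hloc : HasAllSymbolLocality C r δ :=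
    hasAllSymbolLocality_blockParityCheck hδ (by omega) hP₁ hP₂ (hrk.trans hkC)
  have hcard : Fintype.card (BlockCoord w r δ m) = n := by
    rw [card_blockCoord (by omega) (by omega), hn, Nat.add_sub_assoc (by omega)]
  obtain ⟨d, hd⟩ := exists_isLinearCodeWithParams (C := C) <| by
    intro hbot
    rw [hbot, finrank_bot] at hkC
    omega
  rw [hcard] at hd
  have hupper := hd.add_finrank_add_le hloc hn (hk ▸ hkC) hv hmδ hu
  obtain ⟨c, hc, hc0, hcd⟩ := hd.exists_hammingNorm_eq
  have hlower := le_hammingNorm_of_mem_blockParityCheck (by omega) hP₁ hP₂ hα hN hS hc hc0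
  have htight : h + (w - u) * (δ - 1) + 1 + k + (u * (δ - 1) + m) = n + 1 := by
    rw [hn, Nat.add_sub_assoc (by omega), mul_add, ← hhk, hsplit (δ - 1)]
    omega
  have hfinrank : Module.finrank L C = k := by omega
  have hdist : d = h + (w - u) * (δ - 1) + 1 := by omega
  exact ⟨hdist ▸ hfinrank ▸ hd, hloc⟩

theorem distanceBound_eq {n k : ℕ} (hk : k = u * r + v) (hv : 0 < v) (hvr : v ≤ r) :
    distanceBound n k r δ m = (n : ℤ) - k + 1 - u * ((δ : ℤ) - 1) - m := by
  have hr : (0 : ℚ) < r := by exact_mod_cast hv.trans_le hvr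
  have hceil : ⌈(k : ℚ) / r⌉ = (u : ℤ) + 1 := by
    have hv' : (0 : ℚ) < v := by exact_mod_cast hv
    have hvr' : (v : ℚ) ≤ r := by exact_mod_cast hvr
    rw [Int.ceil_eq_iff, hk, lt_div_iff₀ hr, div_le_iff₀ hr]
    push_cast
    constructor <;> linarith
  rw [distanceBound, hceil]
  ring

theorem IsLinearCodeWithParams.minDist_le_distanceBound {ι K : Type*} [Fintype ι] [Field K]
    {C : Submodule K (ι → K)} {n k d : ℕ} (hC : IsLinearCodeWithParams C n k d)
    (hloc : HasAllSymbolLocality C r δ) (hn : n = w * (r + δ - 1) + m) (hk : k = u * r + v)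
    (hv : 0 < v) (hvr : v ≤ r) (hmδ : m ≤ δ - 1) (hu : 2 * (r - v) + max m 2 ≤ u) :
    (d : ℤ) ≤ distanceBound n k r δ m := by
  have hle := hC.add_finrank_add_le hloc hn hk.ge hv hmδ hu
  rw [distanceBound_eq hk hv hvr]
  zify [one_le_two.trans hloc.2.2.1] at hle
  linarith

end Construction

theorem theorem4_general {F L : Type*} [Field F] [Fintype F] [Field L] [Algebra F L]
    (n k w u r v δ m h : ℕ)
    (hn : n = w * (r + δ - 1) + m) (hk : k = u * r + v)
    (hh : (h : ℤ) = n - k - m - w * ((δ : ℤ) - 1))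
    (hδ : 2 ≤ δ) (hv : 0 < v) (hmδ : m ≤ δ - 1)
    (hvr : v ≤ r) (hu : 2 * (r - v) + max m 2 ≤ u)
    (P₁ : Matrix (Fin (m + δ - 1)) (Fin (m + r + δ - 1)) F)
    (hP₁ : IsLinearCodeWithParams (parityCheckCode P₁) (m + r + δ - 1) r (m + δ))
    (P₂ : Matrix (Fin (δ - 1)) (Fin (r + δ - 1)) F)
    (hP₂ : IsLinearCodeWithParams (parityCheckCode P₂) (r + δ - 1) r δ)
    (α : BlockCoord w r δ m → L) (hα : Function.Injective α)
    (hS : IsWiseIndependent F (Set.range α) (h + (w - u) * (δ - 1))) :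
    IsLinearCodeWithParams (parityCheckCode (blockParityCheck h P₁ P₂ α))
        n k (h + (w - u) * (δ - 1) + 1) ∧
      HasAllSymbolLocality (parityCheckCode (blockParityCheck h P₁ P₂ α)) r δ ∧
      ((h + (w - u) * (δ - 1) + 1 : ℕ) : ℤ) = distanceBound n k r δ m ∧
      ∀ (K : Type*) [Field K] (C : Submodule K (Fin n → K)) (d : ℕ),
        IsLinearCodeWithParams C n k d → HasAllSymbolLocality C r δ →
          (d : ℤ) ≤ distanceBound n k r δ m := by
  have hhk : h + k = w * r := by
    zify [show 1 ≤ r + δ by omega] at hn ⊢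
    linarith
  have huw : u < w := lt_of_mul_lt_mul_right' (a := r) (by omega)
  obtain ⟨hcode, hloc⟩ :=
    isLinearCodeWithParams_and_hasAllSymbolLocality_blockParityCheck hn hk hhk hδ hv hvr hmδ hu
      hP₁ hP₂ hα hS
  refine ⟨hcode, hloc, ?_, fun K _ C d hC hCloc ↦
    hC.minDist_le_distanceBound hCloc hn hk hv hvr hmδ hu⟩
  rw [distanceBound_eq hk hv hvr]
  push_cast [huw.le, one_le_two.trans hδ]
  linarith

theorem theorem4 {F L : Type*} [Field F] [Fintype F] [Field L] [Finite L] [Algebra F L]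
    (n k w u r v δ m h : ℕ)
    (hn : n = w * (r + δ - 1) + m) (hk : k = u * r + v)
    (hh : (h : ℤ) = n - k - m - w * ((δ : ℤ) - 1))
    (hv : 0 < v) (hm : 0 < m) (hmδ : m ≤ δ - 1)
    (hvr : v < r) (hrv : r / 2 < v) (hu : 2 * r + δ - 1 ≤ u)
    (P₁ : Matrix (Fin (m + δ - 1)) (Fin (m + r + δ - 1)) F)
    (hP₁ : IsLinearCodeWithParams (parityCheckCode P₁) (m + r + δ - 1) r (m + δ))
    (P₂ : Matrix (Fin (δ - 1)) (Fin (r + δ - 1)) F)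
    (hP₂ : IsLinearCodeWithParams (parityCheckCode P₂) (r + δ - 1) r δ)
    (α : BlockCoord w r δ m → L) (hα : Function.Injective α)
    (hS : IsWiseIndependent F (Set.range α) (h + (w + 1 - u) * (δ - 1))) :
    IsLinearCodeWithParams (parityCheckCode (blockParityCheck h P₁ P₂ α))
        n k (h + (w - u) * (δ - 1) + 1) ∧
      HasAllSymbolLocality (parityCheckCode (blockParityCheck h P₁ P₂ α)) r δ ∧
      ((h + (w - u) * (δ - 1) + 1 : ℕ) : ℤ) = distanceBound n k r δ m ∧
      ∀ (K : Type*) [Field K] [Finite K] (C : Submodule K (Fin n → K)) (d : ℕ),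
        IsLinearCodeWithParams C n k d → HasAllSymbolLocality C r δ →
          (d : ℤ) ≤ distanceBound n k r δ m := by
  obtain ⟨hcode, hloc, hbound, hopt⟩ :=
    theorem4_general n k w u r v δ m h hn hk hh (by omega) hv hmδ hvr.le (by omega) P₁ hP₁ P₂ hP₂ α
      hα fun T hT hcard ↦ hS T hT (hcard.trans (by gcongr; omega))
  exact ⟨hcode, hloc, hbound, fun K _ _ ↦ hopt K⟩
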